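/- The inertia of a real symmetric matrix $A$ is $\mathrm{In}(A)=(\mathbf n_+(A),\mathbf n_0(A),\mathbf n_-(A))$, the numbers of positive, zero and negative eigenvalues of $A$, counted with multiplicity. For a finite simple connected graph $G$ with distance function $d$, the squared distance matrix is $\Delta(G)=[d(u,v)^2]_{u,v\in V(G)}$. A block of $G$ is a maximal connected subgraph of $G$ that has no cut vertex. $G$ is a starlike block graph with central cut vertex $c$ if $G$ is connected, each block of $G$ is a complete graph, and $c$ is a cut vertex of $G$ that belongs to every block. For $b\ge 2$ and integers $n_1,\dots,n_b\ge 1$, $\mathcal S(n_1,\dots,n_b)$ denotes the starlike block graph obtained by gluing the complete graphs $K_{n_1+1},\dots,K_{n_b+1}$ at one common vertex; it has $n=1+\sum_{i=1}^b n_i$ vertices. Theorem. Let $G$ be a starlike block graph on $n$ vertices with central cut vertex $c$, let $\Delta=\Delta(G)$, and let $\Delta_{22}$ be the principal submatrix of $\Delta$ obtained by deleting the row and the column of $c$. Then $$\mathrm{In}(\Delta)=(1,0,n-1),$$ and $\Delta_{22}$ is nonsingular with $$\mathrm{In}(\Delta_{22})=(1,0,n-2).$$ In particular, this holds for $G=\mathcal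 S(n_1,\dots,n_b)$ with $n=1+\sum_{i=1}^b n_i$, for all $b\ge 2$ and $n_1,\dots,n_b\ge 1$. -/

import Mathlib

open scoped Matrix

namespace StarlikeBlock

/-- The distance matrix of a finite simple graph. -/
noncomputable def distMatrix {V : Type*} (G : SimpleGraph V) : Matrix V V ℝ :=
  Matrix.of fun u v => (G.dist u v : ℝ)

/-- The squared distance matrix `Δ(G) = D(G) ∘ D(G)` (entrywise product). -/
noncomputable def sqDistMatrix {V : Type*} (G : SimpleGraph V) : Matrix V V ℝ :=
  distMatrix G ⊙ distMatrix G

/-- The principal submatrix of `Δ(G)` obtained by deleting the row and the column of `c`. -/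
noncomputable def sqDistMatrixMinor {V : Type*} (G : SimpleGraph V) (c : V) :
    Matrix {v : V // v ≠ c} {v : V // v ≠ c} ℝ :=
  (sqDistMatrix G).submatrix Subtype.val Subtype.val

theorem sqDistMatrix_isHermitian {V : Type*} (G : SimpleGraph V) :
    (sqDistMatrix G).IsHermitian := by
  ext u v
  simp [sqDistMatrix, distMatrix, G.dist_comm]

theorem sqDistMatrixMinor_isHermitian {V : Type*} (G : SimpleGraph V) (c : V) :
    (sqDistMatrixMinor G c).IsHermitian :=
  (sqDistMatrix_isHermitian G).submatrix _

/-- The inertia `(n₊, n₀, n₋)` of a real symmetric matrix: the numbers of positive, zero and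
negative eigenvalues, counted with multiplicity. -/
noncomputable def inertia {m : Type*} [Fintype m] [DecidableEq m] (A : Matrix m m ℝ)
    (hA : A.IsHermitian) : ℕ × ℕ × ℕ :=
  ((Finset.univ.filter fun i => 0 < hA.eigenvalues i).card,
   (Finset.univ.filter fun i => hA.eigenvalues i = 0).card,
   (Finset.univ.filter fun i => hA.eigenvalues i < 0).card)

/-- `v` is a cut vertex of the (connected) graph `G`: the graph `G - v` is disconnected, that is,
it has two vertices that are not joined by a walk. The empty graph counts as not disconnected. -/
def IsCutVertex {V : Type*} (G : SimpleGraph V) (v : V) : Prop :=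
  ¬ (G.induce {v}ᶜ).Preconnected

/-- A block of `G`: a maximal connected subgraph of `G` that has no cut vertex (of itself). -/
def IsBlock {V : Type*} (G : SimpleGraph V) (B : G.Subgraph) : Prop :=
  Maximal (fun H : G.Subgraph => H.coe.Connected ∧ ∀ v, ¬ IsCutVertex H.coe v) B

/-- `G` is a starlike block graph with central cut vertex `c`: it is connected, each of its blocks
is a complete graph, and `c` is a cut vertex that lies in all the blocks. -/
structure IsStarlikeBlockGraph {V : Type*} (G : SimpleGraph V) (c : V) : Prop where
  connected : G.Connected
  complete : ∀ B : G.Subgraph, IsBlock G B → B.coe = ⊤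
  isCutVertex : IsCutVertex G c
  central : ∀ B : G.Subgraph, IsBlock G B → c ∈ B.verts

/-- The graph `S(n₁, …, n_b)`: the complete graphs `K_{n₁+1}, …, K_{n_b+1}` glued together at one
common vertex `none`. The vertices `some ⟨i, k⟩`, `k < n i`, are the other vertices of the `i`-th
complete graph. -/
def starlike {b : ℕ} (n : Fin b → ℕ) : SimpleGraph (Option (Σ i : Fin b, Fin (n i))) :=
  -- distinct vertices are adjacent unless they are `some ⟨i, k⟩` and `some ⟨j, l⟩` with `i ≠ j`
  SimpleGraph.fromRel fun u v => ∀ x ∈ u, ∀ y ∈ v, x.1 = y.1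

end StarlikeBlock

namespace StarlikeBlock

open Finset

/-! Blocks being complete and containing `c`, the graph is a bunch of cliques meeting only in `c`.
Off `c` the entries of the matrix are 0, 1 (same clique) or 4, so with `s` the sum of the
coordinates and `s_q` the sum over clique `q`, the form of the minor is `4 s² - 3 ∑ s_q² - ∑ x_u²`,
negative definite on `s = 0`. The full form adds `2 x_c s`, and is negative definite on `x_c = -4
s`. A hyperplane on which the form is negative definite leaves room for at most one nonnegative
eigenvalue; zero trace then forces that eigenvalue to be positive and the rest negative. -/

/-- A traceless real symmetric matrix of order at least two whose quadratic form is negative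
definite on a hyperplane has exactly one positive eigenvalue, and all the others are negative. -/
theorem exists_eigenvalues_pos_neg {m : Type*} [Fintype m] [DecidableEq m] {A : Matrix m m ℝ}
    (hA : A.IsHermitian) (hcard : 2 ≤ Fintype.card m) (htr : A.trace = 0)
    (f : (m → ℝ) →ₗ[ℝ] ℝ) (hf : ∀ x, f x = 0 → x ≠ 0 → x ⬝ᵥ A *ᵥ x < 0) :
    ∃ i, 0 < hA.eigenvalues i ∧ ∀ j, j ≠ i → hA.eigenvalues j < 0 := by
  set b : m → m → ℝ := fun i => (hA.eigenvectorBasis i).ofLp with hb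
  have horth : ∀ i j, b i ⬝ᵥ b j = if i = j then 1 else 0 := by
    intro i j
    have h := orthonormal_iff_ite.mp hA.eigenvectorBasis.orthonormal j i
    rw [EuclideanSpace.inner_eq_star_dotProduct] at h
    simpa [hb, eq_comm] using h
  have hmul : ∀ i, A *ᵥ b i = hA.eigenvalues i • b i := hA.mulVec_eigenvectorBasis
  -- Two nonnegative eigenvalues would make the form nonnegative on a plane, which meets the kernel
  -- of `f` nontrivially.
  have huniq : ∀ i j, i ≠ j → 0 ≤ hA.eigenvalues i → hA.eigenvalues j < 0 := by
    intro i j hij hi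
    by_contra! hj
    have hquad : ∀ p q : ℝ, (p • b i + q • b j) ⬝ᵥ A *ᵥ (p • b i + q • b j)
        = p ^ 2 * hA.eigenvalues i + q ^ 2 * hA.eigenvalues j := by
      intro p q
      simp only [Matrix.mulVec_add, Matrix.mulVec_smul, hmul, add_dotProduct, dotProduct_add,
        smul_dotProduct, dotProduct_smul, horth, hij, hij.symm, smul_eq_mul, if_true, if_false]
      ring
    have hne : ∀ p q : ℝ, p ≠ 0 ∨ q ≠ 0 → p • b i + q • b j ≠ 0 := by
      intro p q hpq h0
      have hp : b i ⬝ᵥ (p • b i + q • b j) = p := by simp [horth, hij]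
      have hq : b j ⬝ᵥ (p • b i + q • b j) = q := by simp [horth, hij.symm]
      rw [h0, dotProduct_zero] at hp hq
      rcases hpq with h | h
      · exact h hp.symm
      · exact h hq.symm
    obtain ⟨p, q, hpq, h0⟩ : ∃ p q : ℝ, (p ≠ 0 ∨ q ≠ 0) ∧ f (p • b i + q • b j) = 0 := by
      by_cases h : f (b i) = 0
      · exact ⟨1, 0, by simp, by simp [h]⟩
      · exact ⟨f (b j), -f (b i), by simp [h], by simp; ring⟩
    have := hf _ h0 (hne p q hpq)
    rw [hquad] at this
    have : 0 ≤ p ^ 2 * hA.eigenvalues i + q ^ 2 * hA.eigenvalues j := by positivity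
    linarith
  have hsum : ∑ i, hA.eigenvalues i = 0 := by
    have h := hA.trace_eq_sum_eigenvalues
    rw [htr] at h
    exact_mod_cast h.symm
  have hnonempty : (univ : Finset m).Nonempty := by
    rw [← card_pos, card_univ]; omega
  obtain ⟨i, hi⟩ : ∃ i, 0 ≤ hA.eigenvalues i := by
    by_contra! h
    exact (sum_neg (fun i _ => h i) hnonempty).ne hsum
  refine ⟨i, ?_, fun j hj => huniq i j hj.symm hi⟩
  -- Order at least two makes this sum nonempty, hence strictly negative.
  have hrest : ∑ j ∈ univ.erase i, hA.eigenvalues j < 0 := by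
    refine sum_neg (fun j hj => huniq i j (ne_of_mem_erase hj).symm hi) ?_
    rw [← card_pos, card_erase_of_mem (mem_univ i), card_univ]; omega
  have := add_sum_erase univ hA.eigenvalues (mem_univ i)
  linarith

theorem inertia_eq_of_trace_eq_zero {m : Type*} [Fintype m] [DecidableEq m] {A : Matrix m m ℝ}
    (hA : A.IsHermitian) (hcard : 2 ≤ Fintype.card m) (htr : A.trace = 0)
    (f : (m → ℝ) →ₗ[ℝ] ℝ) (hf : ∀ x, f x = 0 → x ≠ 0 → x ⬝ᵥ A *ᵥ x < 0) :
    inertia A hA = (1, 0, Fintype.card m - 1) ∧ A.det ≠ 0 := by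
  obtain ⟨i, hi, hneg⟩ := exists_eigenvalues_pos_neg hA hcard htr f hf
  have hne : ∀ j, hA.eigenvalues j ≠ 0 := fun j => by
    rcases eq_or_ne j i with rfl | h
    · exact hi.ne'
    · exact (hneg j h).ne
  refine ⟨?_, ?_⟩
  · have hpos' : (univ.filter fun j => 0 < hA.eigenvalues j) = {i} := by
      ext j
      simp only [mem_filter, mem_univ, true_and, mem_singleton]
      refine ⟨fun h => by_contra fun hj => (hneg j hj).not_gt h, ?_⟩
      rintro rfl
      exact hi
    have hneg' : (univ.filter fun j => hA.eigenvalues j < 0) = univ.erase i := by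
      ext j
      simp only [mem_filter, mem_univ, true_and, mem_erase, and_true]
      refine ⟨?_, hneg j⟩
      rintro h rfl
      exact hi.not_gt h
    simp only [inertia, hpos', hneg', card_singleton, card_erase_of_mem (mem_univ i), card_univ,
      filter_false_of_mem fun j _ => hne j, card_empty]
  · rw [hA.det_eq_prod_eigenvalues]
    exact prod_ne_zero_iff.mpr fun j _ => by simpa using hne j

/-- The quadratic form of the matrix with entries `0` on the diagonal, `1` inside the fibres of `g`
and `4` elsewhere. -/
theorem sum_sum_fibre_eq {W Q : Type*} [Fintype W] [DecidableEq W] [Fintype Q] [DecidableEq Q]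
    (g : W → Q) (x : W → ℝ) :
    ∑ u, ∑ v, x u * ((if u = v then 0 else if g u = g v then 1 else 4) * x v)
      = 4 * (∑ u, x u) ^ 2 - 3 * ∑ q, (∑ u, if g u = q then x u else 0) ^ 2 - ∑ u, x u ^ 2 := by
  -- Entrywise, the matrix is `4 - 3 [g u = g v] - [u = v]`.
  have hfib : ∑ q, (∑ u, if g u = q then x u else 0) ^ 2
      = ∑ u, ∑ v, x u * ((if g u = g v then 1 else 0) * x v) := by
    simp only [sq, sum_mul_sum]
    rw [sum_comm]
    refine sum_congr rfl fun u _ => ?_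
    rw [sum_comm]
    refine sum_congr rfl fun v _ => ?_
    by_cases h : g u = g v <;> simp [h, eq_comm]
  have hdiag : ∑ u, x u ^ 2 = ∑ u, ∑ v, x u * ((if u = v then 1 else 0) * x v) := by
    simp [sq]
  rw [hfib, hdiag, sq, sum_mul_sum, mul_sum, mul_sum, ← sum_sub_distrib, ← sum_sub_distrib]
  refine sum_congr rfl fun u _ => ?_
  rw [mul_sum, mul_sum, ← sum_sub_distrib, ← sum_sub_distrib]
  refine sum_congr rfl fun v _ => ?_
  by_cases h : u = v
  · subst h; simp; ring
  · by_cases h' : g u = g v <;> simp [h, h'] <;> ring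

/-- All vertices are adjacent to `c`, and adjacency is transitive on the other vertices: `G` is a
union of complete graphs that pairwise meet only in `c`. -/
structure IsCliqueStar {V : Type*} (G : SimpleGraph V) (c : V) : Prop where
  adj_center : ∀ v, v ≠ c → G.Adj c v
  trans : ∀ u v w, u ≠ c → v ≠ c → w ≠ c → G.Adj u v → G.Adj v w → u ≠ w → G.Adj u w

namespace IsCliqueStar

variable {V : Type*} {G : SimpleGraph V} {c : V}

/-- Two vertices other than the centre are related if they are equal or adjacent. -/
def setoid (h : IsCliqueStar G c) : Setoid {v : V // v ≠ c} where
  r u v := u = v ∨ G.Adj u v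
  iseqv :=
    { refl := fun _ => Or.inl rfl
      symm := by
        rintro u v (rfl | huv)
        · exact Or.inl rfl
        · exact Or.inr huv.symm
      trans := by
        rintro u v w (rfl | huv) (rfl | hvw)
        · exact Or.inl rfl
        · exact Or.inr hvw
        · exact Or.inr huv
        · by_cases huw : u = w
          · exact Or.inl huw
          · exact Or.inr (h.trans u v w u.2 v.2 w.2 huv hvw fun e => huw (Subtype.ext e)) }

theorem dist_eq_two (h : IsCliqueStar G c) {u v : V} (hu : u ≠ c) (hv : v ≠ c) (huv : u ≠ v)
    (hadj : ¬ G.Adj u v) : G.dist u v = 2 := by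
  let p : G.Walk u v := .cons (h.adj_center u hu).symm (.cons (h.adj_center v hv) .nil)
  have hle : G.dist u v ≤ 2 := SimpleGraph.dist_le p
  have h0 : G.dist u v ≠ 0 := fun e => huv ((p.reachable.dist_eq_zero_iff).mp e)
  have h1 : G.dist u v ≠ 1 := fun e => hadj (SimpleGraph.dist_eq_one_iff_adj.mp e)
  omega

theorem sqDistMatrix_apply [DecidableEq V] (h : IsCliqueStar G c)
    [DecidableEq (Quotient h.setoid)] (u v : {v : V // v ≠ c}) :
    sqDistMatrix G u v = if u = v then 0 else
      if Quotient.mk h.setoid u = Quotient.mk h.setoid v then 1 else 4 := by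
  by_cases huv : u = v
  · simp [sqDistMatrix, distMatrix, huv]
  by_cases hadj : G.Adj u v
  · have : Quotient.mk h.setoid u = Quotient.mk h.setoid v := Quotient.sound (Or.inr hadj)
    simp [sqDistMatrix, distMatrix, huv, this, SimpleGraph.dist_eq_one_iff_adj.mpr hadj]
  · have : Quotient.mk h.setoid u ≠ Quotient.mk h.setoid v := fun e =>
      (Quotient.exact e).elim huv hadj
    simp [sqDistMatrix, distMatrix, huv, this,
      h.dist_eq_two u.2 v.2 (fun e => huv (Subtype.ext e)) hadj]
    norm_num

theorem sqDistMatrix_center_apply (h : IsCliqueStar G c) {v : V} (hv : v ≠ c) :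
    sqDistMatrix G c v = 1 := by
  simp [sqDistMatrix, distMatrix, SimpleGraph.dist_eq_one_iff_adj.mpr (h.adj_center v hv)]

variable [Fintype V] [DecidableEq V]

theorem minor_quadForm_le (h : IsCliqueStar G c) (x : {v : V // v ≠ c} → ℝ) :
    x ⬝ᵥ sqDistMatrixMinor G c *ᵥ x ≤ 4 * (∑ u, x u) ^ 2 - ∑ u, x u ^ 2 := by
  classical
  simp only [dotProduct, Matrix.mulVec, mul_sum, sqDistMatrixMinor, Matrix.submatrix_apply,
    h.sqDistMatrix_apply]
  rw [sum_sum_fibre_eq (Quotient.mk h.setoid) x]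
  have : 0 ≤ ∑ q, (∑ u, if Quotient.mk h.setoid u = q then x u else 0) ^ 2 :=
    sum_nonneg fun _ _ => sq_nonneg _
  linarith

theorem quadForm_eq (h : IsCliqueStar G c) (x : V → ℝ) :
    x ⬝ᵥ sqDistMatrix G *ᵥ x = 2 * x c * ∑ u : {v : V // v ≠ c}, x u
      + (fun u : {v : V // v ≠ c} => x u) ⬝ᵥ sqDistMatrixMinor G c *ᵥ fun u => x u := by
  have hcol : ∀ u : {v : V // v ≠ c}, sqDistMatrix G u c = 1 := fun u => by
    rw [← h.sqDistMatrix_center_apply u.2]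
    exact congrFun₂ (sqDistMatrix_isHermitian G) c u
  have hcc : sqDistMatrix G c c = 0 := by simp [sqDistMatrix, distMatrix]
  simp only [dotProduct, Matrix.mulVec, Fintype.sum_eq_add_sum_subtype_ne _ c, hcol, hcc,
    fun u : {v : V // v ≠ c} => h.sqDistMatrix_center_apply u.2, sqDistMatrixMinor,
    Matrix.submatrix_apply, mul_add, sum_add_distrib, ← sum_mul, one_mul, zero_mul, mul_zero,
    zero_add]
  ring

theorem inertia_eq (h : IsCliqueStar G c) (hcard : 3 ≤ Fintype.card V) :
    inertia (sqDistMatrix G) (sqDistMatrix_isHermitian G) = (1, 0, Fintype.card V - 1) ∧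
    (sqDistMatrixMinor G c).det ≠ 0 ∧
    inertia (sqDistMatrixMinor G c) (sqDistMatrixMinor_isHermitian G c)
      = (1, 0, Fintype.card V - 2) := by
  have hW : Fintype.card {v : V // v ≠ c} = Fintype.card V - 1 := by
    simp [Fintype.card_subtype_compl]
  have hsq : ∀ x : {v : V // v ≠ c} → ℝ, 0 ≤ ∑ u, x u ^ 2 := fun x =>
    sum_nonneg fun _ _ => sq_nonneg _
  have hsq_pos : ∀ x : {v : V // v ≠ c} → ℝ, x ≠ 0 → 0 < ∑ u, x u ^ 2 := by
    intro x hx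
    obtain ⟨u, hu⟩ := Function.ne_iff.mp hx
    exact sum_pos' (fun _ _ => sq_nonneg _) ⟨u, mem_univ u, sq_pos_of_ne_zero hu⟩
  obtain ⟨hin, hdet⟩ := inertia_eq_of_trace_eq_zero (sqDistMatrixMinor_isHermitian G c)
    (by omega) (by simp [Matrix.trace, sqDistMatrixMinor, sqDistMatrix, distMatrix])
    (∑ u, LinearMap.proj u) (fun x hx hx0 => by
      have hs : ∑ u, x u = 0 := by simpa using hx
      have := h.minor_quadForm_le x
      rw [hs] at this
      linarith [hsq_pos x hx0])
  refine ⟨(inertia_eq_of_trace_eq_zero (sqDistMatrix_isHermitian G) (by omega)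
    (by simp [Matrix.trace, sqDistMatrix, distMatrix])
    -- On `x c = -4 s` the terms `2 x_c s + 4 s²` become `-4 s²`.
    (LinearMap.proj c + (4 : ℝ) • ∑ u : {v : V // v ≠ c}, LinearMap.proj u.1)
    fun x hx hx0 => ?_).1, hdet, ?_⟩
  · have hs : x c + 4 * ∑ u : {v : V // v ≠ c}, x u = 0 := by simpa using hx
    rw [h.quadForm_eq x]
    have hle := h.minor_quadForm_le fun u => x u
    set s := ∑ u : {v : V // v ≠ c}, x u
    have hc : x c = -4 * s := by linarith
    rw [hc]
    -- If the coordinates off `c` vanish, then `s = 0`, so `x c = 0` as well.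
    by_cases hx' : (fun u : {v : V // v ≠ c} => x u) = 0
    · refine absurd (funext fun v => ?_) hx0
      by_cases hv : v = c
      · have : s = 0 := sum_eq_zero fun u _ => congrFun hx' u
        rw [hv, hc, this]; simp
      · exact congrFun hx' ⟨v, hv⟩
    · have := hsq_pos _ hx'
      nlinarith [sq_nonneg s]
  · rw [hin, hW, Nat.sub_sub]

end IsCliqueStar

theorem preconnected_of_forall_adj {V : Type*} {G : SimpleGraph V} (a : V)
    (h : ∀ v, v ≠ a → G.Adj a v) : G.Preconnected := by
  have hr : ∀ v, G.Reachable a v := fun v => by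
    rcases eq_or_ne v a with rfl | hv
    · exact .refl _
    · exact (h v hv).reachable
  exact fun u v => (hr u).symm.trans (hr v)

/-- A set in which two distinct vertices are adjacent to all the others lies in a block. -/
theorem exists_isBlock_superset {V : Type*} [Finite V] {G : SimpleGraph V} {S : Set V} {a b : V}
    (ha : a ∈ S) (hb : b ∈ S) (hab : a ≠ b) (hadja : ∀ v ∈ S, v ≠ a → G.Adj a v)
    (hadjb : ∀ v ∈ S, v ≠ b → G.Adj b v) : ∃ B, IsBlock G B ∧ S ⊆ B.verts := by
  let H : G.Subgraph := (⊤ : G.Subgraph).induce S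
  have hH : H.coe.Connected ∧ ∀ v, ¬ IsCutVertex H.coe v := by
    constructor
    · have : Nonempty H.verts := ⟨⟨a, ha⟩⟩
      refine ⟨preconnected_of_forall_adj ⟨a, ha⟩ fun v hv => ?_⟩
      exact ⟨ha, v.2, hadja v v.2 fun e => hv (Subtype.ext e)⟩
    · intro v
      simp only [IsCutVertex, not_not]
      -- Deleting one vertex leaves `a` or `b` as a vertex adjacent to all the others.
      by_cases hv : v.1 = a
      · refine preconnected_of_forall_adj
          ⟨⟨b, hb⟩, fun e => hab (hv.symm.trans (congrArg Subtype.val e).symm)⟩ fun w hw => ?_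
        exact ⟨hb, w.1.2, hadjb w.1 w.1.2 fun e => hw (Subtype.ext (Subtype.ext e))⟩
      · refine preconnected_of_forall_adj
          ⟨⟨a, ha⟩, fun e => hv (congrArg Subtype.val e).symm⟩ fun w hw => ?_
        exact ⟨ha, w.1.2, hadja w.1 w.1.2 fun e => hw (Subtype.ext (Subtype.ext e))⟩
  obtain ⟨B, hle, hB⟩ := Finite.exists_le_maximal
    (p := fun H : G.Subgraph => H.coe.Connected ∧ ∀ v, ¬ IsCutVertex H.coe v) hH
  exact ⟨B, hB, hle.1⟩

theorem IsStarlikeBlockGraph.adj_of_mem_isBlock {V : Type*} {G : SimpleGraph V} {c : V}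
    (h : IsStarlikeBlockGraph G c) {B : G.Subgraph} (hB : IsBlock G B) {u v : V}
    (hu : u ∈ B.verts) (hv : v ∈ B.verts) (huv : u ≠ v) : G.Adj u v := by
  have : B.coe.Adj ⟨u, hu⟩ ⟨v, hv⟩ := by
    rw [h.complete B hB]
    exact fun e => huv (congrArg Subtype.val e)
  exact B.adj_sub this

/-- Every edge lies in a block, which also contains `c` and is complete; this gives adjacency to
`c`. -/
theorem IsStarlikeBlockGraph.isCliqueStar {V : Type*} [Finite V] {G : SimpleGraph V} {c : V}
    (h : IsStarlikeBlockGraph G c) : IsCliqueStar G c := by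
  have hcenter : ∀ v, v ≠ c → G.Adj c v := by
    intro v hv
    have : Nontrivial V := ⟨v, c, hv⟩
    obtain ⟨w, hw⟩ := h.connected.preconnected.exists_adj_of_nontrivial v
    obtain ⟨B, hB, hS⟩ := exists_isBlock_superset (G := G) (S := {v, w}) (a := v) (b := w)
      (by simp) (by simp) hw.ne (by rintro x (rfl | rfl) hx <;> [exact absurd rfl hx; exact hw])
      (by rintro x (rfl | rfl) hx <;> [exact hw.symm; exact absurd rfl hx])
    exact h.adj_of_mem_isBlock hB (h.central B hB) (hS (by simp)) hv.symm
  refine ⟨hcenter, fun u v w hu hv hw huv hvw huw => ?_⟩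
  -- Both `c` and `v` dominate this set, so a single block contains `u` and `w`.
  obtain ⟨B, hB, hS⟩ := exists_isBlock_superset (G := G) (S := {c, u, v, w}) (a := c) (b := v)
    (by simp) (by simp) hv.symm (fun x _ hx => hcenter x hx) (by
      rintro x (rfl | rfl | rfl | rfl) hx
      · exact (hcenter v hv).symm
      · exact huv.symm
      · exact absurd rfl hx
      · exact hvw)
  exact h.adj_of_mem_isBlock hB (hS (by simp)) (hS (by simp)) huw

/-- The cut vertex separates two others; the minor thus has order at least two, as the trace
argument requires. -/
theorem IsStarlikeBlockGraph.three_le_card {V : Type*} [Fintype V] {G : SimpleGraph V} {c : V}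
    (h : IsStarlikeBlockGraph G c) : 3 ≤ Fintype.card V := by
  classical
  have hcut := h.isCutVertex
  simp only [IsCutVertex, SimpleGraph.Preconnected, not_forall] at hcut
  obtain ⟨u, v, huv⟩ := hcut
  have hne : u.1 ≠ v.1 := fun e => huv (Subtype.ext e ▸ .refl _)
  have : ({u.1, v.1, c} : Finset V).card = 3 := card_eq_three.mpr ⟨_, _, _, hne, u.2, v.2, rfl⟩
  exact this ▸ card_le_univ _

theorem starlike_isCliqueStar {b : ℕ} (n : Fin b → ℕ) : IsCliqueStar (starlike n) none := by
  constructor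
  · intro v hv
    simp [starlike, hv.symm]
  · rintro (_ | u) (_ | v) (_ | w) hu hv hw huv hvw huw
    all_goals try contradiction
    simp only [starlike, SimpleGraph.fromRel_adj, Option.mem_def, Option.some.injEq,
      forall_eq'] at huv hvw ⊢
    have h1 : u.1 = v.1 := huv.2.elim id Eq.symm
    have h2 : v.1 = w.1 := hvw.2.elim id Eq.symm
    exact ⟨huw, Or.inl (h1.trans h2)⟩

end StarlikeBlock

theorem theorem2p10 :
    -- every starlike block graph `G` with central cut vertex `c`
    (∀ (V : Type*) [Fintype V] [DecidableEq V] (G : SimpleGraph V) (c : V),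
      StarlikeBlock.IsStarlikeBlockGraph G c →
        StarlikeBlock.inertia (StarlikeBlock.sqDistMatrix G) (StarlikeBlock.sqDistMatrix_isHermitian G)
            = (1, 0, Fintype.card V - 1) ∧
        (StarlikeBlock.sqDistMatrixMinor G c).det ≠ 0 ∧
        StarlikeBlock.inertia (StarlikeBlock.sqDistMatrixMinor G c)
            (StarlikeBlock.sqDistMatrixMinor_isHermitian G c)
            = (1, 0, Fintype.card V - 2)) ∧
    -- in particular the graphs `S(n₁, …, n_b)` on `N = 1 + n₁ + ⋯ + n_b` vertices
    (∀ (b : ℕ) (n : Fin b → ℕ) (N : ℕ), 2 ≤ b → (∀ i, 1 ≤ n i) → N = 1 + ∑ i, n i →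
        StarlikeBlock.inertia (StarlikeBlock.sqDistMatrix (StarlikeBlock.starlike n))
            (StarlikeBlock.sqDistMatrix_isHermitian (StarlikeBlock.starlike n))
            = (1, 0, N - 1) ∧
        (StarlikeBlock.sqDistMatrixMinor (StarlikeBlock.starlike n) none).det ≠ 0 ∧
        StarlikeBlock.inertia (StarlikeBlock.sqDistMatrixMinor (StarlikeBlock.starlike n) none)
            (StarlikeBlock.sqDistMatrixMinor_isHermitian (StarlikeBlock.starlike n) none)
            = (1, 0, N - 2)) := by
  refine ⟨fun V _ _ G c h => h.isCliqueStar.inertia_eq h.three_le_card, ?_⟩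
  intro b n N hb hn hN
  have hcard : Fintype.card (Option (Σ i : Fin b, Fin (n i))) = N := by
    simp [hN, add_comm]
  have hsum : b ≤ ∑ i, n i := by
    simpa using Finset.sum_le_sum fun i (_ : i ∈ Finset.univ) => hn i
  have h := (StarlikeBlock.starlike_isCliqueStar n).inertia_eq (by omega)
  rwa [hcard] at h
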